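/- **Setting.** Consider a Markov decision process with a finite set $\mathcal S$ of non-sink states, an additional sink state $e\notin\mathcal S$, a finite nonempty set $\mathcal A$ of actions, transition probabilities $p(s,a,s')$ and real rewards $r(s,a,s')$ of arbitrary sign for $s,s'\in\bar{\mathcal S}=\mathcal S\cup\{e\}$, $a\in\mathcal A$, where $p(e,a,e)=1$ and $r(e,a,e)=0$ for all $a$. A decision rule is a map $d\colon\mathcal S\to\Delta(\mathcal A)$, with $d_a(s)$ the probability of taking $a$ in $s$; it is deterministic if every $d(s)$ is a point mass. A Markov policy is a sequence $\pi=(d_0,d_1,\dots)$ of decision rules, and it is deterministic if each $d_k$ is; $(d)_\infty=(d,d,\dots)$ is the stationary policy of $d$. Write $\mathbb P^{\pi,s}$, $\mathbb E^{\pi,s}$ for the law of $(\tilde s_0,\tilde a_0,\tilde s_1,\dots)$ under $\pi$ with $\tilde s_0=s$. The MDP is assumed transient: for every stationary deterministic policy $\pi$ and all $s,s'\in\mathcal S$, $\sum_{t=0}^\infty\mathbb P^{\pi,s}[\tilde s_t=s']<\infty$. Fix a risk level $\beta>0$. For $t\in\mathbb N$, $s\in\mathcal S$ put $$v^t_s(\pi)=-\beta^{-1}\log\mathbb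 E^{\pi,s}\Big[\exp\Big(-\beta\sum_{k=0}^{t-1}r(\tilde s_k,\tilde a_k,\tilde s_{k+1})\Big)\Big],\qquad v^{t,\star}_s=\max_{\pi}v^t_s(\pi),$$ the maximum being over deterministic Markov policies; put $w^t_s(\pi)=-\exp(-\beta v^t_s(\pi))$, $w^{t,\star}_s=-\exp(-\beta v^{t,\star}_s)$, and, componentwise in the extended reals, $w^\infty(\pi)=\liminf_{t\to\infty}w^t(\pi)$, $w^{\infty,\star}=\liminf_{t\to\infty}w^{t,\star}$. For a decision rule $d$, the exponential Bellman operator $L^d\colon\mathbb R^{\mathcal S}\to\mathbb R^{\mathcal S}$ is $L^dw=B^dw-b^d$, where $$B^d_{s,s'}=\sum_{a\in\mathcal A}p(s,a,s')\,d_a(s)\,e^{-\beta r(s,a,s')},\qquad b^d_s=\sum_{a\in\mathcal A}p(s,a,e)\,d_a(s)\,e^{-\beta r(s,a,e)}\qquad(s,s'\in\mathcal S).$$ **Theorem.** If $w^{\infty,\star}_s>-\infty$ for every $s\in\mathcal S$, then there is a deterministic decision rule $d^\star$ such that $w^{\infty,\star}\in\mathbb R^{\mathcal S}$ and $$w^{\infty,\star}=w^\infty((d^\star)_\infty)=L^{d^\star}w^{\infty,\star},$$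 and $w^{\infty,\star}$ is the unique $w\in\mathbb R^{\mathcal S}$ with $w=L^{d^\star}w$. -/

import Mathlib

/-- A finite Markov decision process with non-sink states `S` and actions `A`.
The full state space is `Option S`; the state `none` is the absorbing, reward-free sink. -/
structure SinkMDP (S A : Type*) [Fintype S] [Fintype A] where
  /-- transition probabilities -/
  p : Option S → A → Option S → ℝ
  /-- rewards -/
  r : Option S → A → Option S → ℝ
  p_nonneg : ∀ s a s', 0 ≤ p s a s'
  p_sum : ∀ s a, ∑ s', p s a s' = 1
  p_sink : ∀ a, p none a none = 1
  r_sink : ∀ a, r none a none = 0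

namespace SinkMDP

/-- A (randomized) decision rule: a probability distribution over the actions for every
non-sink state. -/
abbrev DecisionRule (S A : Type*) [Fintype A] : Type _ := S → stdSimplex ℝ A

open Classical in
/-- A deterministic decision rule `S → A`, as a (degenerate) randomized one. -/
noncomputable def det {S A : Type*} [Fintype A] (d : S → A) : DecisionRule S A :=
  fun s => ⟨Pi.single (d s) 1, single_mem_stdSimplex ℝ (d s)⟩

open Classical in
/-- Probability of choosing action `a` in state `s` under the decision rule `d`.
In the sink, where the choice is irrelevant, an arbitrary fixed action is taken. -/
noncomputable def actionProb {S A : Type*} [Fintype A] [Nonempty A] (d : DecisionRule S A)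
    (s : Option S) (a : A) : ℝ :=
  match s with
  | some s => (d s).1 a
  | none => if a = Classical.arbitrary A then 1 else 0

/-- Trajectories over `t` steps: states `s₀, …, s_t` and actions `a₀, …, a_{t-1}`. -/
abbrev Traj (S A : Type*) (t : ℕ) : Type _ := (Fin (t + 1) → Option S) × (Fin t → A)

/-- The entropic risk measure `-β⁻¹ log 𝔼[exp (-β X)]` of a random variable `X` on a finite
probability space `Ω` with probability weights `P`. -/
noncomputable def erm {Ω : Type*} [Fintype Ω] (P : Ω → ℝ) (β : ℝ) (X : Ω → ℝ) : ℝ :=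
  -β⁻¹ * Real.log (∑ ω, P ω * Real.exp (-β * X ω))

variable {S A : Type*} [Fintype S] [Fintype A] [Nonempty A] (M : SinkMDP S A)

open Classical in
/-- The law of the trajectory over `t` steps, starting in `s` and following the Markov policy
`π = (d₀, …, d_{t-1})`. -/
noncomputable def trajProb {t : ℕ} (π : Fin t → DecisionRule S A) (s : Option S)
    (ω : Traj S A t) : ℝ :=
  (if ω.1 0 = s then (1 : ℝ) else 0) *
    ∏ k : Fin t, (actionProb (π k) (ω.1 k.castSucc) (ω.2 k) *
      M.p (ω.1 k.castSucc) (ω.2 k) (ω.1 k.succ))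

open Classical in
/-- `ℙ^{π,s}[s_t = s']` for the Markov policy `π = (d₀, …, d_{t-1})`. -/
noncomputable def stateProb {t : ℕ} (π : Fin t → DecisionRule S A) (s s' : Option S) : ℝ :=
  ∑ ω : Traj S A t, if ω.1 (Fin.last t) = s' then M.trajProb π s ω else 0

/-- The MDP is transient: under every stationary deterministic policy, the expected number of
visits to each non-sink state is finite, from every non-sink initial state. -/
def Transient : Prop :=
  ∀ (d : S → A) (s s' : S),
    Summable fun t : ℕ => M.stateProb (fun _ : Fin t => det d) (some s) (some s')

/-- Total reward `∑_{k=0}^{t-1} r(s_k, a_k, s_{k+1})` of a trajectory. -/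
def totalReward {t : ℕ} (ω : Traj S A t) : ℝ :=
  ∑ k : Fin t, M.r (ω.1 k.castSucc) (ω.2 k) (ω.1 k.succ)

/-- `v^t_s(π)`, the ERM of the total reward over `t` steps. -/
noncomputable def v (β : ℝ) {t : ℕ} (π : Fin t → DecisionRule S A) (s : S) : ℝ :=
  erm (M.trajProb π (some s)) β M.totalReward

/-- `v^{t,⋆}_s`, the maximum of `v^t_s(π)` over the deterministic Markov policies `π` of
horizon `t`. These form a finite nonempty set, so that the supremum is a maximum. -/
noncomputable def vStar (β : ℝ) (t : ℕ) (s : S) : ℝ :=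
  ⨆ π : Fin t → S → A, M.v β (fun k => det (π k)) s

/-- Exponential value `w^t_s(π)`. -/
noncomputable def w (β : ℝ) {t : ℕ} (π : Fin t → DecisionRule S A) (s : S) : ℝ :=
  -Real.exp (-β * M.v β π s)

/-- Optimal exponential value `w^{t,⋆}_s`. -/
noncomputable def wStar (β : ℝ) (t : ℕ) (s : S) : ℝ :=
  -Real.exp (-β * M.vStar β t s)

/-- `w^∞(π) = liminf_t w^t(π)` (componentwise, in the extended reals) for an infinite-horizon
Markov policy `π = (d₀, d₁, …)`. -/
noncomputable def wInf (β : ℝ) (π : ℕ → DecisionRule S A) (s : S) : EReal :=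
  Filter.liminf (fun t : ℕ => ((M.w β (fun k : Fin t => π k) s : ℝ) : EReal)) Filter.atTop

/-- `w^{∞,⋆} = liminf_t w^{t,⋆}` (componentwise, in the extended reals). -/
noncomputable def wInfStar (β : ℝ) (s : S) : EReal :=
  Filter.liminf (fun t : ℕ => ((M.wStar β t s : ℝ) : EReal)) Filter.atTop

/-- The stationary policy `(d)_∞ = (d, d, …)`. -/
def stationary {S A : Type*} [Fintype A] (d : DecisionRule S A) : ℕ → DecisionRule S A :=
  fun _ => d

/-- The exponential transition matrix `B^d`. -/
noncomputable def expMatrix {S A : Type*} [Fintype S] [Fintype A] (M : SinkMDP S A) (β : ℝ)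
    (d : DecisionRule S A) : Matrix S S ℝ :=
  Matrix.of fun s s' => ∑ a, M.p (some s) a (some s') * (d s).1 a *
    Real.exp (-β * M.r (some s) a (some s'))

/-- The exponential termination vector `b^d`. -/
noncomputable def expVector {S A : Type*} [Fintype S] [Fintype A] (M : SinkMDP S A) (β : ℝ)
    (d : DecisionRule S A) : S → ℝ :=
  fun s => ∑ a, M.p (some s) a none * (d s).1 a * Real.exp (-β * M.r (some s) a none)

/-- The exponential Bellman operator `L^d w = B^d w - b^d`. -/
noncomputable def bellman {S A : Type*} [Fintype S] [Fintype A] (M : SinkMDP S A) (β : ℝ)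
    (d : DecisionRule S A) (w : S → ℝ) : S → ℝ :=
  (M.expMatrix β d).mulVec w - M.expVector β d

end SinkMDP

open Filter Topology

namespace SinkMDP

/-! ### Nonnegative matrices, supersolutions and affine fixed points. -/

section NonnegMatrix

variable {S : Type*} [Fintype S] {B : Matrix S S ℝ}

/-! Work with the optimal costs `v t = -wStar t ≥ 0`, which are eventually bounded by hypothesis.
Their tail infima increase to a limit `l`. A greedy rule for the tail infimum at `t` bounds the next
one from below by a Bellman image. Some rule `d` is greedy infinitely often, so in the limit `B l +
b ≤ l` for that rule (`exists_supersolution_liminf`).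

Transience makes every nonnegative supersolution positive (`Transient.supersolution_pos`), and with
one supersolution at hand this forces `B ^ t → 0` (`tendsto_pow_mulVec_zero`), although `B` need not
be substochastic. Hence `x = B x + b` has a unique solution, the costs of the stationary policy
converge to `x`, and `x ≤ l`. The optimal cost is at most the stationary one, and its liminf is at
least `l ≥ x`; so both converge to `x`. -/

theorem mulVec_mono_of_nonneg (hB : ∀ i j, 0 ≤ B i j) {x y : S → ℝ} (h : x ≤ y) :
    B.mulVec x ≤ B.mulVec y := fun i =>
  Finset.sum_le_sum fun j _ => mul_le_mul_of_nonneg_left (h j) (hB i j)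

theorem tendsto_mulVec (B : Matrix S S ℝ) {x : ℕ → S → ℝ} {y : S → ℝ}
    (h : Tendsto x atTop (𝓝 y)) : Tendsto (fun t => B.mulVec (x t)) atTop (𝓝 (B.mulVec y)) :=
  ((Continuous.matrix_mulVec continuous_const continuous_id).tendsto y).comp h

theorem exists_le_smul_of_pos {u : S → ℝ} (hu : ∀ s, 0 < u s) (x : S → ℝ) :
    ∃ C : ℝ, x ≤ C • u := by
  obtain ⟨C, hC⟩ := (Set.finite_range fun s => x s / u s).bddAbove
  exact ⟨C, fun s => (div_le_iff₀ (hu s)).1 (hC ⟨s, rfl⟩)⟩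

theorem exists_lt_one_le_smul {u y : S → ℝ} (hu : ∀ s, 0 < u s) (hy : ∀ s, y s < u s) :
    ∃ c : ℝ, c < 1 ∧ y ≤ c • u := by
  rcases isEmpty_or_nonempty S with h | h
  · exact ⟨0, one_pos, fun s => isEmptyElim s⟩
  · obtain ⟨s₀, hs₀⟩ := Finite.exists_max fun s => y s / u s
    exact ⟨y s₀ / u s₀, (div_lt_one (hu s₀)).2 (hy s₀), fun s => (div_le_iff₀ (hu s)).1 (hs₀ s)⟩

variable [DecidableEq S]

theorem pow_succ_mulVec (B : Matrix S S ℝ) (t : ℕ) (x : S → ℝ) :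
    (B ^ (t + 1)).mulVec x = B.mulVec ((B ^ t).mulVec x) := by
  rw [pow_succ', Matrix.mulVec_mulVec]

theorem pow_nonneg_entries (hB : ∀ i j, 0 ≤ B i j) (t : ℕ) : ∀ i j, 0 ≤ (B ^ t) i j := by
  induction t with
  | zero => intro i j; rw [pow_zero, Matrix.one_apply]; split_ifs <;> norm_num
  | succ t ih =>
    intro i j
    rw [pow_succ', Matrix.mul_apply]
    exact Finset.sum_nonneg fun k _ => mul_nonneg (hB i k) (ih k j)

/-- If every nonnegative supersolution of `z = B z + b` is positive, and there is one, then the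
powers of `B` tend to zero. -/
theorem tendsto_pow_mulVec_zero (hB : ∀ i j, 0 ≤ B i j) {b u : S → ℝ}
    (hpos : ∀ z : S → ℝ, 0 ≤ z → B.mulVec z + b ≤ z → ∀ s, 0 < z s)
    (hb : 0 ≤ b) (hu0 : 0 ≤ u) (hu : B.mulVec u + b ≤ u) (x : S → ℝ) :
    Tendsto (fun t : ℕ => (B ^ t).mulVec x) atTop (𝓝 0) := by
  have hBu : B.mulVec u ≤ u := le_trans (le_add_of_nonneg_right hb) hu
  have hanti : Antitone fun t : ℕ => (B ^ t).mulVec u := by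
    refine antitone_nat_of_succ_le fun t => ?_
    rw [pow_succ, ← Matrix.mulVec_mulVec]
    exact mulVec_mono_of_nonneg (pow_nonneg_entries hB t) hBu
  have hnn : ∀ t : ℕ, 0 ≤ (B ^ t).mulVec u := fun t => by
    have := mulVec_mono_of_nonneg (pow_nonneg_entries hB t) hu0
    rwa [Matrix.mulVec_zero] at this
  have hlim : ∀ s, ∃ y, Tendsto (fun t : ℕ => (B ^ t).mulVec u s) atTop (𝓝 y) := fun s =>
    ⟨_, tendsto_atTop_ciInf (fun _ _ h => hanti h s) ⟨0, by rintro _ ⟨t, rfl⟩; exact hnn t s⟩⟩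
  choose y hy using hlim
  have hy' : Tendsto (fun t : ℕ => (B ^ t).mulVec u) atTop (𝓝 y) := tendsto_pi_nhds.2 hy
  have hyfix : B.mulVec y = y := by
    refine tendsto_nhds_unique (tendsto_mulVec B hy') ?_
    simp_rw [← pow_succ_mulVec]
    exact (tendsto_add_atTop_iff_nat 1).2 hy'
  have hyu : y ≤ u := fun s => by
    have hle := le_of_tendsto' (hy s) fun t => hanti (Nat.zero_le t) s
    simpa using hle
  have hzpos := hpos (u - y) (sub_nonneg.2 hyu) (by
    rw [Matrix.mulVec_sub, hyfix, sub_add_eq_add_sub]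
    exact sub_le_sub_right hu y)
  have hupos := hpos u hu0 hu
  obtain ⟨c, hc, hyc⟩ := exists_lt_one_le_smul hupos fun s => sub_pos.1 (hzpos s)
  have hypow : ∀ t : ℕ, (B ^ t).mulVec y = y := fun t => by
    induction t with
    | zero => simp
    | succ t ih => rw [pow_succ_mulVec, ih, hyfix]
  -- Applying `B ^ t` to `y ≤ c • u` fixes the left side and sends the right side to `c • y`; with
  -- `c < 1` and `0 ≤ y` this kills `y`.
  have hyle : y ≤ c • y := by
    refine ge_of_tendsto' (hy'.const_smul c) fun t => ?_
    have := mulVec_mono_of_nonneg (pow_nonneg_entries hB t) hyc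
    rwa [hypow, Matrix.mulVec_smul] at this
  have hy0 : ∀ s, y s = 0 := fun s => by
    have h1 : y s ≤ c * y s := hyle s
    have h2 : 0 ≤ y s := ge_of_tendsto' (hy s) fun t => hnn t s
    nlinarith
  obtain ⟨C, hC⟩ := exists_le_smul_of_pos hupos x
  obtain ⟨D, hD⟩ := exists_le_smul_of_pos hupos (-x)
  refine tendsto_pi_nhds.2 fun s => ?_
  have hys := hy s
  rw [hy0 s] at hys
  refine tendsto_of_tendsto_of_tendsto_of_le_of_le (g := fun t : ℕ => -(D * (B ^ t).mulVec u s))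
    (h := fun t : ℕ => C * (B ^ t).mulVec u s) ?_ ?_ (fun t => ?_) fun t => ?_
  · simpa using (hys.const_mul D).neg
  · simpa using hys.const_mul C
  · have := mulVec_mono_of_nonneg (pow_nonneg_entries hB t) hD s
    rw [Matrix.mulVec_neg, Matrix.mulVec_smul] at this
    exact neg_le.1 this
  · have := mulVec_mono_of_nonneg (pow_nonneg_entries hB t) hC s
    rwa [Matrix.mulVec_smul] at this

theorem pow_mulVec_eq_self {x : S → ℝ} (hx : B.mulVec x = x) (t : ℕ) : (B ^ t).mulVec x = x := by
  induction t with
  | zero => simp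
  | succ t ih => rw [pow_succ_mulVec, ih, hx]

theorem eq_zero_of_mulVec_eq_self {x : S → ℝ} (hx : B.mulVec x = x)
    (h : Tendsto (fun t : ℕ => (B ^ t).mulVec x) atTop (𝓝 0)) : x = 0 := by
  simp_rw [pow_mulVec_eq_self hx] at h
  exact tendsto_nhds_unique tendsto_const_nhds h

/-- `1 - B` is injective, since a fixed vector of `B` is the limit of its own iterates; in finite
dimension it is then surjective. -/
theorem exists_eq_mulVec_add
    (h : ∀ x : S → ℝ, Tendsto (fun t : ℕ => (B ^ t).mulVec x) atTop (𝓝 0)) (b : S → ℝ) :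
    ∃ x : S → ℝ, x = B.mulVec x + b := by
  have hinj : Function.Injective ((LinearMap.id : (S → ℝ) →ₗ[ℝ] S → ℝ) - B.mulVecLin) := by
    refine (injective_iff_map_eq_zero _).2 fun x hx => eq_zero_of_mulVec_eq_self ?_ (h x)
    exact (sub_eq_zero.1 hx).symm
  obtain ⟨x, hx⟩ := LinearMap.surjective_of_injective hinj b
  exact ⟨x, (sub_eq_iff_eq_add'.1 hx)⟩

theorem tendsto_of_affine_recursion
    (h : ∀ x : S → ℝ, Tendsto (fun t : ℕ => (B ^ t).mulVec x) atTop (𝓝 0)) {b x : S → ℝ}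
    (hx : x = B.mulVec x + b) {v : ℕ → S → ℝ} (hv : ∀ t, v (t + 1) = B.mulVec (v t) + b) :
    Tendsto v atTop (𝓝 x) := by
  have key : ∀ t, v t = (B ^ t).mulVec (v 0 - x) + x := fun t => by
    induction t with
    | zero => simp
    | succ t ih =>
      rw [hv, ih, pow_succ_mulVec, Matrix.mulVec_add, add_assoc, ← hx]
  have := (h (v 0 - x)).add_const x
  rw [zero_add] at this
  exact this.congr fun t => (key t).symm

/-- The difference satisfies `B (u - x) ≤ u - x`; iterating bounds `u - x` below by `B ^ t (u - x) →
0`. -/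
theorem le_of_supersolution (hB : ∀ i j, 0 ≤ B i j)
    (h : ∀ x : S → ℝ, Tendsto (fun t : ℕ => (B ^ t).mulVec x) atTop (𝓝 0)) {b x u : S → ℝ}
    (hx : x = B.mulVec x + b) (hu : B.mulVec u + b ≤ u) : x ≤ u := by
  have hstep : B.mulVec (u - x) ≤ u - x := by
    rw [Matrix.mulVec_sub]
    have : u - x = u - (B.mulVec x + b) := by rw [← hx]
    rw [this, sub_add_eq_sub_sub_swap]
    exact sub_le_sub_right (le_sub_iff_add_le.2 hu) _
  have key : ∀ t : ℕ, (B ^ t).mulVec (u - x) ≤ u - x := fun t => by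
    induction t with
    | zero => simp
    | succ t ih =>
      rw [pow_succ_mulVec]
      exact (mulVec_mono_of_nonneg hB ih).trans hstep
  exact sub_nonneg.1 (le_of_tendsto' (h _) key)

end NonnegMatrix

/-! ### Lower limits of Bellman-dominating sequences. -/

section Limits

/-- A bounded sequence of vectors that dominates, at each step, one of finitely many affine
images of its predecessor has a lower limit that dominates one of its own images. -/
theorem exists_supersolution_liminf {S D : Type*} [Fintype S] [Finite D]
    (B : D → Matrix S S ℝ) (b : D → S → ℝ) {v : ℕ → S → ℝ}
    (h0 : ∀ t, 0 ≤ v t) {C : S → ℝ} {N : ℕ} (hC : ∀ t ≥ N, v t ≤ C)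
    (hstep : ∀ x : S → ℝ, ∃ d, ∀ t, x ≤ v t → (B d).mulVec x + b d ≤ v (t + 1)) :
    ∃ d, ∃ l : S → ℝ, 0 ≤ l ∧ (B d).mulVec l + b d ≤ l ∧
      ∀ s, ∀ c < l s, ∀ᶠ t in atTop, c < v t s := by
  let m : ℕ → S → ℝ := fun t s => ⨅ k, v (t + k) s
  have hbdd : ∀ t s, BddBelow (Set.range fun k => v (t + k) s) := fun t s =>
    ⟨0, by rintro _ ⟨k, rfl⟩; exact h0 _ s⟩
  have hm_le : ∀ t k, t ≤ k → m t ≤ v k := fun t k htk s => by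
    obtain ⟨j, rfl⟩ := Nat.exists_eq_add_of_le htk
    exact ciInf_le (hbdd t s) j
  have hle_m : ∀ t (x : S → ℝ), (∀ k ≥ t, x ≤ v k) → x ≤ m t := fun t x hx s =>
    le_ciInf fun k => hx _ (Nat.le_add_right t k) s
  have hmono : Monotone m := fun t t' h => hle_m _ _ fun k hk => hm_le _ _ (h.trans hk)
  have hlim : ∀ s, ∃ y, Tendsto (fun t => m t s) atTop (𝓝 y) := fun s =>
    ⟨_, tendsto_atTop_ciSup (fun _ _ h => hmono h s) ⟨C s, by
      rintro _ ⟨t, rfl⟩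
      exact (hm_le t (max t N) (le_max_left _ _) s).trans (hC _ (le_max_right _ _) s)⟩⟩
  choose l hl using hlim
  have hl' : Tendsto m atTop (𝓝 l) := tendsto_pi_nhds.2 hl
  choose f hf using fun t => hstep (m t)
  -- Pigeonhole: finitely many rules. Frequent occurrence suffices to pass the inequality to the
  -- limit.
  obtain ⟨d, hd⟩ : ∃ d, ∃ᶠ t in atTop, f t = d := by
    by_contra! hcon
    obtain ⟨t, ht⟩ := (eventually_all.2 hcon).exists
    exact ht _ rfl
  refine ⟨d, l, ?_, ?_, fun s c hc => ?_⟩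
  · exact ge_of_tendsto' hl' fun t => hle_m _ _ fun k _ => h0 k
  · refine le_of_tendsto_of_tendsto_of_frequently ((tendsto_mulVec (B d) hl').add_const (b d))
      ((tendsto_add_atTop_iff_nat 1).2 hl') (hd.mono fun t ht => ?_)
    refine hle_m _ _ fun k hk => ?_
    obtain ⟨j, rfl⟩ : ∃ j, k = j + 1 := ⟨k - 1, by omega⟩
    rw [← ht]
    exact hf t j (hm_le _ _ (by omega))
  · obtain ⟨t, ht⟩ := ((hl s).eventually (lt_mem_nhds hc)).exists
    exact eventually_atTop.2 ⟨t, fun k hk => ht.trans_le (hm_le _ _ hk s)⟩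

end Limits

/-! ### First-step decomposition of sums over trajectories. -/

section Trajectories

variable {S A : Type*} [Fintype S] [Fintype A]

open Classical in
/-- Sum over trajectories from `s` of a product of step weights times a terminal weight. -/
noncomputable def trajSum {t : ℕ} (q : Fin t → Option S → A → Option S → ℝ) (g : Option S → ℝ)
    (s : Option S) : ℝ :=
  ∑ ω : Traj S A t, (if ω.1 0 = s then (1 : ℝ) else 0) *
    (∏ k : Fin t, q k (ω.1 k.castSucc) (ω.2 k) (ω.1 k.succ)) * g (ω.1 (Fin.last t))

theorem trajSum_zero (q : Fin 0 → Option S → A → Option S → ℝ) (g : Option S → ℝ)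
    (s : Option S) : trajSum q g s = g s := by
  classical
  unfold trajSum
  rw [Fintype.sum_prod_type, Finset.sum_comm, Fintype.sum_unique,
    ← (Equiv.funUnique (Fin 1) (Option S)).symm.sum_comp]
  simp

theorem trajSum_succ {t : ℕ} (q : Fin (t + 1) → Option S → A → Option S → ℝ)
    (g : Option S → ℝ) (s : Option S) :
    trajSum q g s = ∑ a, ∑ x, q 0 s a x * trajSum (fun k => q k.succ) g x := by
  classical
  unfold trajSum
  simp_rw [Finset.mul_sum]
  have hR : ∀ a : A, (∑ x, ∑ ω : Traj S A t, q 0 s a x *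
      ((if ω.1 0 = x then (1 : ℝ) else 0) *
        (∏ k : Fin t, q k.succ (ω.1 k.castSucc) (ω.2 k) (ω.1 k.succ)) * g (ω.1 (Fin.last t)))) =
      ∑ ω : Traj S A t, q 0 s a (ω.1 0) *
        ((∏ k : Fin t, q k.succ (ω.1 k.castSucc) (ω.2 k) (ω.1 k.succ)) *
          g (ω.1 (Fin.last t))) := fun a => by
    rw [Finset.sum_comm]
    refine Finset.sum_congr rfl fun ω _ => ?_
    rw [Finset.sum_eq_single (ω.1 0)]
    · simp
    · intro x _ hx
      simp [Ne.symm hx]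
    · simp
  simp_rw [hR]
  -- Splits off the initial state and the first action.
  let e : (Option S × A) × Traj S A t ≃ Traj S A (t + 1) :=
    (Equiv.prodProdProdComm _ _ _ _).trans
      (Equiv.prodCongr (Fin.consEquiv fun _ => Option S) (Fin.consEquiv fun _ => A))
  rw [← e.sum_comp, Fintype.sum_prod_type, Fintype.sum_prod_type, Finset.sum_comm]
  refine Finset.sum_congr rfl fun a _ => ?_
  rw [Finset.sum_comm]
  refine Finset.sum_congr rfl fun ω _ => ?_
  rw [Finset.sum_eq_single s]
  · simp [e, Fin.prod_univ_succ, Fin.consEquiv, ← Fin.succ_last, mul_assoc]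
  · intro x _ hx
    simp [e, Fin.consEquiv, hx]
  · simp

end Trajectories

variable {S A : Type*} [Fintype S] [Fintype A] [Nonempty A] (M : SinkMDP S A)

/-! ### State probabilities and closed sets. -/

section Transience

/-- One-step transition weights under a decision rule. -/
noncomputable def stepProb (d : DecisionRule S A) (s : Option S) (a : A) (x : Option S) : ℝ :=
  actionProb d s a * M.p s a x

theorem stateProb_eq_trajSum [DecidableEq S] {t : ℕ} (π : Fin t → DecisionRule S A)
    (s s' : Option S) :
    M.stateProb π s s' =
      trajSum (fun k => M.stepProb (π k)) (fun x => if x = s' then 1 else 0) s := by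
  classical
  unfold stateProb trajSum trajProb stepProb
  refine Finset.sum_congr rfl fun ω _ => ?_
  by_cases h : ω.1 (Fin.last t) = s' <;> simp [h]

theorem sum_actionProb_det {S A : Type*} [Fintype A] [Nonempty A]
    (d : S → A) (s : S) (f : A → ℝ) :
    ∑ a, actionProb (det d) (some s) a * f a = f (d s) := by
  classical
  rw [Finset.sum_eq_single (d s)]
  · simp [actionProb, det]
  · intro a _ ha
    simp [actionProb, det, ha]
  · simp

theorem actionProb_none {S A : Type*} [Fintype A] [Nonempty A]
    (d : DecisionRule S A) (f : A → ℝ) :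
    ∑ a, actionProb d none a * f a = f (Classical.arbitrary A) := by
  classical
  simp [actionProb]

theorem stateProb_zero [DecidableEq S] (π : Fin 0 → DecisionRule S A) (s s' : Option S) :
    M.stateProb π s s' = if s = s' then 1 else 0 := by
  rw [stateProb_eq_trajSum, trajSum_zero]

theorem stateProb_det_succ (d : S → A) (t : ℕ) (s : S) (s' : Option S) :
    M.stateProb (fun _ : Fin (t + 1) => det d) (some s) s' =
      ∑ x, M.p (some s) (d s) x * M.stateProb (fun _ : Fin t => det d) x s' := by
  classical
  simp_rw [stateProb_eq_trajSum, trajSum_succ]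
  simp_rw [stepProb, mul_assoc, ← Finset.mul_sum]
  rw [sum_actionProb_det]

theorem actionProb_nonneg {S A : Type*} [Fintype A] [Nonempty A]
    (d : DecisionRule S A) (s : Option S) (a : A) :
    0 ≤ actionProb d s a := by
  classical
  cases s with
  | none => simp only [actionProb]; split_ifs <;> norm_num
  | some s => exact (d s).2.1 a

theorem trajProb_nonneg {t : ℕ} (π : Fin t → DecisionRule S A) (s : Option S)
    (ω : Traj S A t) : 0 ≤ M.trajProb π s ω := by
  classical
  refine mul_nonneg (by split_ifs <;> norm_num) (Finset.prod_nonneg fun k _ => ?_)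
  exact mul_nonneg (actionProb_nonneg _ _ _) (M.p_nonneg _ _ _)

theorem stateProb_nonneg {t : ℕ} (π : Fin t → DecisionRule S A) (s s' : Option S) :
    0 ≤ M.stateProb π s s' := by
  classical
  refine Finset.sum_nonneg fun ω _ => ?_
  split_ifs
  · exact M.trajProb_nonneg _ _ _
  · exact le_rfl

/-- In a transient MDP, a set of non-sink states that is closed under a stationary policy is
empty. -/
theorem Transient.closed_eq_empty {M : SinkMDP S A} (hM : M.Transient) (d : S → A)
    (Z : Finset S) (hZ : ∀ s ∈ Z, ∑ x ∈ Z, M.p (some s) (d s) (some x) = 1) : Z = ∅ := by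
  classical
  by_contra hne
  obtain ⟨s, hs⟩ := Finset.nonempty_iff_ne_empty.2 hne
  -- The mass in a closed set never drops below one, whereas summability drives it to zero.
  have key : ∀ t : ℕ, ∀ s ∈ Z,
      1 ≤ ∑ s' ∈ Z, M.stateProb (fun _ : Fin t => det d) (some s) (some s') := by
    intro t
    induction t with
    | zero => intro s hs; simp [stateProb_zero, hs]
    | succ t ih =>
      intro s hs
      simp_rw [stateProb_det_succ]
      rw [Finset.sum_comm, ← hZ s hs, Fintype.sum_option]
      simp_rw [← Finset.mul_sum]
      refine le_add_of_nonneg_of_le (mul_nonneg (M.p_nonneg _ _ _)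
        (Finset.sum_nonneg fun _ _ => M.stateProb_nonneg _ _ _)) ?_
      refine (Finset.sum_le_sum fun x hx => le_mul_of_one_le_right (M.p_nonneg _ _ _)
        (ih x hx)).trans (Finset.sum_le_sum_of_subset_of_nonneg (Finset.subset_univ Z)
          fun x _ _ => mul_nonneg (M.p_nonneg _ _ _)
            (Finset.sum_nonneg fun _ _ => M.stateProb_nonneg _ _ _))
  have hlim := tendsto_finsetSum Z fun s' _ => (hM d s s').tendsto_atTop_zero
  rw [Finset.sum_const_zero] at hlim
  exact absurd (ge_of_tendsto' hlim fun t => key t s hs) (by norm_num)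

end Transience

/-! ### Exponential costs and their Bellman recursion. -/

section Bellman

variable (β : ℝ)

theorem expMatrix_det (d : S → A) (s s' : S) :
    M.expMatrix β (det d) s s' =
      M.p (some s) (d s) (some s') * Real.exp (-β * M.r (some s) (d s) (some s')) := by
  rw [← sum_actionProb_det d s fun a =>
    M.p (some s) a (some s') * Real.exp (-β * M.r (some s) a (some s'))]
  exact Finset.sum_congr rfl fun a _ => by simp only [actionProb]; ring

theorem expVector_det (d : S → A) (s : S) :
    M.expVector β (det d) s =
      M.p (some s) (d s) none * Real.exp (-β * M.r (some s) (d s) none) := by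
  rw [← sum_actionProb_det d s fun a =>
    M.p (some s) a none * Real.exp (-β * M.r (some s) a none)]
  exact Finset.sum_congr rfl fun a _ => by simp only [actionProb]; ring

theorem expMatrix_det_nonneg (d : S → A) (s s' : S) : 0 ≤ M.expMatrix β (det d) s s' := by
  rw [expMatrix_det]
  exact mul_nonneg (M.p_nonneg _ _ _) (Real.exp_pos _).le

theorem expVector_det_nonneg (d : S → A) : 0 ≤ M.expVector β (det d) := fun s => by
  rw [expVector_det]
  exact mul_nonneg (M.p_nonneg _ _ _) (Real.exp_pos _).le

/-- Nonnegative supersolutions of the Bellman equation are positive in a transient MDP. -/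
theorem Transient.supersolution_pos {M : SinkMDP S A} (hM : M.Transient) (d : S → A)
    {z : S → ℝ} (hz0 : 0 ≤ z)
    (hz : (M.expMatrix β (det d)).mulVec z + M.expVector β (det d) ≤ z) (s : S) : 0 < z s := by
  classical
  refine lt_of_le_of_ne (hz0 s) fun hs => ?_
  -- Where `z` vanishes, so do all the nonnegative terms of `B z + b`. The exponential factors are
  -- positive, so every transition from a zero of `z` leads to a zero: the zero set is closed.
  have hempty := hM.closed_eq_empty d (Finset.univ.filter fun s => z s = 0) fun x hx => by
    have hx0 : z x = 0 := (Finset.mem_filter.1 hx).2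
    have h1 : (M.expMatrix β (det d)).mulVec z x + M.expVector β (det d) x ≤ z x := hz x
    have hterm : ∀ y, 0 ≤ M.expMatrix β (det d) x y * z y := fun y =>
      mul_nonneg (M.expMatrix_det_nonneg β d x y) (hz0 y)
    have hA : 0 ≤ (M.expMatrix β (det d)).mulVec z x := Finset.sum_nonneg fun y _ => hterm y
    have hb : 0 ≤ M.expVector β (det d) x := M.expVector_det_nonneg β d x
    have hAz : ∑ y, M.expMatrix β (det d) x y * z y = 0 :=
      le_antisymm (show (M.expMatrix β (det d)).mulVec z x ≤ 0 by linarith) hA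
    have hbz : M.expVector β (det d) x = 0 := by linarith
    rw [expVector_det, mul_eq_zero, or_iff_left (Real.exp_ne_zero _)] at hbz
    have hsum := M.p_sum (some x) (d x)
    rw [Fintype.sum_option, hbz, zero_add] at hsum
    rw [← hsum]
    refine Finset.sum_subset (Finset.subset_univ _) fun y _ hy => ?_
    have hy0 : z y ≠ 0 := fun h => hy (by simp [h])
    have := (Finset.sum_eq_zero_iff_of_nonneg fun y _ => hterm y).1 hAz y (Finset.mem_univ y)
    rw [expMatrix_det, mul_eq_zero, or_iff_left hy0, mul_eq_zero,
      or_iff_left (Real.exp_ne_zero _)] at this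
    exact this
  have : s ∈ (Finset.univ.filter fun s => z s = 0) := by simp [← hs]
  simp [hempty] at this

/-- Expected exponential cost `𝔼[exp (-β ∑ r)]` of a deterministic policy. -/
noncomputable def expCost {t : ℕ} (π : Fin t → S → A) (s : Option S) : ℝ :=
  ∑ ω, M.trajProb (fun k => det (π k)) s ω * Real.exp (-β * M.totalReward ω)

theorem expCost_eq_trajSum {t : ℕ} (π : Fin t → S → A) (s : Option S) :
    M.expCost β π s = trajSum (fun k s a x => actionProb (det (π k)) s a *
      (M.p s a x * Real.exp (-β * M.r s a x))) (fun _ => 1) s := by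
  classical
  unfold expCost trajSum trajProb totalReward
  refine Finset.sum_congr rfl fun ω _ => ?_
  rw [Finset.mul_sum, Real.exp_sum, mul_one, mul_assoc, ← Finset.prod_mul_distrib]
  simp_rw [mul_assoc]

theorem expCost_zero (π : Fin 0 → S → A) (s : Option S) : M.expCost β π s = 1 := by
  rw [expCost_eq_trajSum, trajSum_zero]

theorem expCost_none {t : ℕ} (π : Fin t → S → A) : M.expCost β π none = 1 := by
  induction t with
  | zero => exact M.expCost_zero β π none
  | succ t ih =>
    have hp : ∀ x : S, M.p none (Classical.arbitrary A) (some x) = 0 := fun x => by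
      have h := M.p_sum none (Classical.arbitrary A)
      rw [Fintype.sum_option, M.p_sink, add_eq_left,
        Finset.sum_eq_zero_iff_of_nonneg fun _ _ => M.p_nonneg _ _ _] at h
      exact h x (Finset.mem_univ x)
    have ih' := ih fun k => π k.succ
    rw [expCost_eq_trajSum] at ih'
    rw [expCost_eq_trajSum, trajSum_succ]
    simp_rw [mul_assoc, ← Finset.mul_sum]
    rw [actionProb_none, Fintype.sum_option, ih']
    simp [hp, M.p_sink, M.r_sink]

theorem expCost_succ {t : ℕ} (π : Fin (t + 1) → S → A) :
    (fun s => M.expCost β π (some s)) =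
      (M.expMatrix β (det (π 0))).mulVec (fun s => M.expCost β (fun k => π k.succ) (some s)) +
        M.expVector β (det (π 0)) := by
  funext s
  rw [expCost_eq_trajSum, trajSum_succ]
  simp_rw [mul_assoc, ← Finset.mul_sum]
  rw [sum_actionProb_det]
  have h := M.expCost_none β fun k => π k.succ
  rw [expCost_eq_trajSum] at h
  rw [Fintype.sum_option, h, Pi.add_apply, expVector_det, add_comm, mul_one]
  congr 1
  refine Finset.sum_congr rfl fun x _ => ?_
  beta_reduce
  rw [expMatrix_det, expCost_eq_trajSum, mul_assoc]

theorem expCost_nonneg {t : ℕ} (π : Fin t → S → A) (s : Option S) : 0 ≤ M.expCost β π s :=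
  Finset.sum_nonneg fun _ _ => mul_nonneg (M.trajProb_nonneg _ _ _) (Real.exp_pos _).le

theorem expCost_pos {t : ℕ} (π : Fin t → S → A) (s : S) : 0 < M.expCost β π (some s) := by
  induction t generalizing s with
  | zero => rw [expCost_zero]; exact one_pos
  | succ t ih =>
    have hE : M.expCost β π (some s) = _ := congrFun (M.expCost_succ β π) s
    refine lt_of_le_of_ne (M.expCost_nonneg β π _) fun h0 => ?_
    rw [← h0, Pi.add_apply] at hE
    have hterm : ∀ x ∈ Finset.univ, 0 ≤ M.expMatrix β (det (π 0)) s x *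
        M.expCost β (fun k => π k.succ) (some x) := fun x _ =>
      mul_nonneg (M.expMatrix_det_nonneg β _ s x) (ih _ x).le
    have hb : 0 ≤ M.expVector β (det (π 0)) s := M.expVector_det_nonneg β (π 0) s
    obtain ⟨h1, h2⟩ := (add_eq_zero_iff_of_nonneg (Finset.sum_nonneg hterm) hb).1 hE.symm
    rw [expVector_det, mul_eq_zero, or_iff_left (Real.exp_ne_zero _)] at h2
    have hp : ∀ x, M.p (some s) (π 0 s) (some x) = 0 := fun x => by
      have := (Finset.sum_eq_zero_iff_of_nonneg hterm).1 h1 x (Finset.mem_univ x)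
      rw [expMatrix_det, mul_eq_zero, or_iff_left (ih _ x).ne', mul_eq_zero,
        or_iff_left (Real.exp_ne_zero _)] at this
      exact this
    have hsum := M.p_sum (some s) (π 0 s)
    rw [Fintype.sum_option, h2] at hsum
    simp [hp] at hsum

end Bellman

/-! ### Optimal values and greedy rules. -/

section Optimality

variable {β : ℝ}

theorem w_det (hβ : 0 < β) {t : ℕ} (π : Fin t → S → A) (s : S) :
    M.w β (fun k => det (π k)) s = -M.expCost β π (some s) := by
  have h : M.v β (fun k => det (π k)) s = -β⁻¹ * Real.log (M.expCost β π (some s)) := rfl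
  rw [w, h, ← mul_assoc, neg_mul_neg, mul_inv_cancel₀ hβ.ne', one_mul,
    Real.exp_log (M.expCost_pos β π s)]

theorem w_le_wStar (hβ : 0 < β) {t : ℕ} (π : Fin t → S → A) (s : S) :
    -M.expCost β π (some s) ≤ M.wStar β t s := by
  classical
  rw [← M.w_det hβ]
  refine neg_le_neg (Real.exp_le_exp.2 (mul_le_mul_of_nonpos_left ?_ (neg_nonpos.2 hβ.le)))
  exact le_ciSup (f := fun π : Fin t → S → A => M.v β (fun k => det (π k)) s)
    (Set.finite_range _).bddAbove π

theorem exists_wStar_eq (hβ : 0 < β) (t : ℕ) (s : S) :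
    ∃ π : Fin t → S → A, M.wStar β t s = -M.expCost β π (some s) := by
  obtain ⟨π, hπ⟩ := exists_eq_ciSup_of_finite
    (f := fun π : Fin t → S → A => M.v β (fun k => det (π k)) s)
  refine ⟨π, ?_⟩
  rw [← M.w_det hβ, wStar, w, vStar, ← hπ]

/-- Row `s` of the Bellman image depends on the rule only through its action at `s`, so the
minimization separates over states. -/
theorem exists_greedy (β : ℝ) (x : S → ℝ) : ∃ d : S → A, ∀ d' : S → A,
    (M.expMatrix β (det d)).mulVec x + M.expVector β (det d) ≤
      (M.expMatrix β (det d')).mulVec x + M.expVector β (det d') := by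
  let Q : S → A → ℝ := fun s a =>
    (∑ y, M.p (some s) a (some y) * Real.exp (-β * M.r (some s) a (some y)) * x y) +
      M.p (some s) a none * Real.exp (-β * M.r (some s) a none)
  have hQ : ∀ d : S → A, (M.expMatrix β (det d)).mulVec x + M.expVector β (det d) =
      fun s => Q s (d s) := fun d => by
    funext s
    rw [Pi.add_apply, expVector_det, Matrix.mulVec, dotProduct]
    simp_rw [expMatrix_det]
    rfl
  choose d hd using fun s => Finite.exists_min (Q s)
  exact ⟨d, fun d' => by rw [hQ, hQ]; exact fun s => hd s _⟩

/-- The rule is greedy for `x` alone, hence uniform in `t`. An optimal policy may depend on the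
initial state; its tail still costs at least the optimum for horizon `t`, hence at least `x`. -/
theorem exists_bellman_le_neg_wStar_succ (hβ : 0 < β) (x : S → ℝ) :
    ∃ d : S → A, ∀ t, x ≤ (fun s => -M.wStar β t s) →
      (M.expMatrix β (det d)).mulVec x + M.expVector β (det d) ≤
        fun s => -M.wStar β (t + 1) s := by
  obtain ⟨d, hd⟩ := M.exists_greedy β x
  refine ⟨d, fun t hx s => ?_⟩
  obtain ⟨π, hπ⟩ := M.exists_wStar_eq hβ (t + 1) s
  have hx' : x ≤ fun s => M.expCost β (fun k => π k.succ) (some s) := fun y =>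
    (hx y).trans (neg_le.1 (M.w_le_wStar hβ (fun k => π k.succ) y))
  have h2 := mulVec_mono_of_nonneg (M.expMatrix_det_nonneg β (π 0)) hx' s
  have h3 : M.expCost β π (some s) = _ := congrFun (M.expCost_succ β π) s
  show _ ≤ -M.wStar β (t + 1) s
  rw [hπ, neg_neg, h3]
  exact (hd (π 0) s).trans (add_le_add_left h2 _)

end Optimality

end SinkMDP

theorem mainTheorem1 {S A : Type*} [Fintype S] [Fintype A] [Nonempty A] (M : SinkMDP S A)
    (hM : M.Transient) (β : ℝ) (hβ : 0 < β) (hfin : ∀ s, ⊥ < M.wInfStar β s) :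
    ∃ d : S → A,
      (∀ s, M.wInfStar β s = M.wInf β (SinkMDP.stationary (SinkMDP.det d)) s) ∧
      ∃ w : S → ℝ, (∀ s, M.wInfStar β s = (w s : EReal)) ∧
        w = M.bellman β (SinkMDP.det d) w ∧
        ∀ u : S → ℝ, u = M.bellman β (SinkMDP.det d) u → u = w := by
  classical
  have hbound : ∀ s, ∃ c : ℝ, ∀ᶠ t in atTop, -M.wStar β t s ≤ c := fun s => by
    obtain ⟨c, -, hc⟩ := EReal.lt_iff_exists_real_btwn.1 (hfin s)
    refine ⟨-c, (eventually_lt_of_lt_liminf hc).mono fun t ht => ?_⟩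
    exact neg_le_neg (EReal.coe_lt_coe_iff.1 ht).le
  choose C hC using hbound
  obtain ⟨N, hN⟩ := eventually_atTop.1 (eventually_all.2 hC)
  obtain ⟨d, l, hl0, hl, hlt⟩ := SinkMDP.exists_supersolution_liminf
    (fun d : S → A => M.expMatrix β (SinkMDP.det d))
    (fun d => M.expVector β (SinkMDP.det d)) (v := fun t s => -M.wStar β t s)
    (fun t s => by
      obtain ⟨π, hπ⟩ := M.exists_wStar_eq hβ t s
      simpa [hπ] using M.expCost_nonneg β π (some s))
    (fun t ht s => hN t ht s) (M.exists_bellman_le_neg_wStar_succ hβ)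
  have hB := M.expMatrix_det_nonneg β d
  have hpow := SinkMDP.tendsto_pow_mulVec_zero hB (fun z hz0 hz => hM.supersolution_pos β d hz0 hz)
    (M.expVector_det_nonneg β d) hl0 hl
  obtain ⟨x, hx⟩ := SinkMDP.exists_eq_mulVec_add hpow (M.expVector β (SinkMDP.det d))
  have hxl := SinkMDP.le_of_supersolution hB hpow hx hl
  have hcost := SinkMDP.tendsto_of_affine_recursion hpow hx
    (v := fun t s => M.expCost β (fun _ : Fin t => d) (some s)) fun t => M.expCost_succ β _
  have hw : ∀ s, Tendsto (fun t => M.w β (fun _ : Fin t => SinkMDP.det d) s) atTop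
      (𝓝 (-x s)) := fun s => by
    simp_rw [M.w_det hβ fun _ => d]
    exact (tendsto_pi_nhds.1 hcost s).neg
  -- Sandwich: the stationary policy is admissible for each horizon, and the optimal cost eventually
  -- exceeds every number below `l s ≥ x s`.
  have hwStar : ∀ s, Tendsto (fun t => M.wStar β t s) atTop (𝓝 (-x s)) := fun s => by
    refine tendsto_order.2 ⟨fun c hc => ?_, fun c hc => ?_⟩
    · filter_upwards [(hw s).eventually (lt_mem_nhds hc)] with t ht
      rw [M.w_det hβ fun _ => d] at ht
      exact ht.trans_le (M.w_le_wStar hβ _ s)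
    · filter_upwards [hlt s (-c) ((neg_lt.1 hc).trans_le (hxl s))] with t ht
      exact neg_lt_neg_iff.1 ht
  have hInf : ∀ s, M.wInf β (SinkMDP.stationary (SinkMDP.det d)) s = ((-x) s : ℝ) := fun s =>
    ((continuous_coe_real_ereal.tendsto _).comp (hw s)).liminf_eq
  have hInfStar : ∀ s, M.wInfStar β s = ((-x) s : ℝ) := fun s =>
    ((continuous_coe_real_ereal.tendsto _).comp (hwStar s)).liminf_eq
  have hfix : -x = M.bellman β (SinkMDP.det d) (-x) := by
    rw [SinkMDP.bellman, Matrix.mulVec_neg, ← neg_add', ← hx]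
  refine ⟨d, fun s => (hInfStar s).trans (hInf s).symm, -x, hInfStar, hfix, fun u hu => ?_⟩
  refine sub_eq_zero.1 (SinkMDP.eq_zero_of_mulVec_eq_self ?_ (hpow _))
  conv_rhs => rw [hu, hfix, SinkMDP.bellman, SinkMDP.bellman, sub_sub_sub_cancel_right]
  rw [Matrix.mulVec_sub]
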